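/- Let $N\ge 1$, let $B=[b_{ij}]\in\mathbb{R}^{N\times N}$ be the adjacency matrix of a strongly connected signed digraph without self-loops ($b_{ii}=0$; there is an edge $(i,j)$ exactly when $b_{ij}\neq0$), let $\sigma_1,\dots,\sigma_N>0$, $\Sigma=\mathrm{diag}\{\sigma_1,\dots,\sigma_N\}$ and $E=B-\Sigma$. Write $\rho(\cdot)$ for the spectral radius and $H(M)=\frac12(M+M^{\mathrm T})$. A real square matrix $M$ is eventually positive if there is a positive integer $k_0$ such that $M^k$ is entrywise positive for all $k\ge k_0$. Assume that one of the following holds: (A1) $B$ is eventually positive and $\sigma_1=\dots=\sigma_N=:d\ge\rho(B)$; in this case put $C=B$; (A2) $B$ is not eventually positive, and for some real $d$ the matrix $C=B+dI-\Sigma$ (so that $E=C-dI$) is eventually positive with $d\ge\rho(C)$. Assume also that there is a diagonal matrix $\Gamma$ with positive diagonal entries such that $H(\Gamma E)$ is negative semidefinite and $\operatorname{rank}H(\Gamma E)=\operatorname{rank}E$. Let $v_r$ denote a right eigenvector of $C$ with positive entries, and consider solutions $x:[0,\infty)\to\mathbb{R}^N$ of $$\dot x=(I-\mathrm{diag}(x)^2)\,E\,x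 .$$ 1) If $x(0)\in(-1,1)^N$, then $\lim_{t\to\infty}x(t)=\alpha v_r$ for some $\alpha\in\left(-\frac1{\|v_r\|_\infty},\frac1{\|v_r\|_\infty}\right)$. 2) Let $\mathcal I\subset\{1,\dots,N\}$ be a nonempty proper subset, let $P$ be a permutation matrix that lists the indices in $\mathcal I$ first, and let $PEP^{\mathrm T}=\begin{bmatrix}\bar E_{11}&\bar E_{12}\\ \bar E_{21}&\bar E_{22}\end{bmatrix}$ be partitioned accordingly. Let $y_1^*\in\{-1,1\}^{|\mathcal I|}$, suppose that $\bar E_{22}$ is nonsingular, and that every entry of $y_2^*:=-\bar E_{22}^{-1}\bar E_{21}y_1^*$ lies in $(-1,1)$. Then every solution whose initial components with index in $\mathcal I$ are given by $y_1^*$ (in the order of $P$), and whose other initial components lie in $(-1,1)$, converges to $x^*=P^{\mathrm T}\begin{bmatrix}y_1^*\\ y_2^*\end{bmatrix}$ as $t\to\infty$. Let $\mathcal J=\{j: v_{r,j}=\|v_r\|_\infty\}$. 3) If $d=\rho(C)$ and $v_r\ne\mathbf 1$, then every solution with $x_i(0)=1$ for $i\in\mathcal J$ and $x_i(0)\in(-1,1)$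 for $i\notin\mathcal J$ converges to $\frac1{\|v_r\|_\infty}v_r$ as $t\to\infty$. 4) If $d=\rho(C)$ and $v_r\ne\mathbf 1$, then every solution with $x_i(0)=-1$ for $i\in\mathcal J$ and $x_i(0)\in(-1,1)$ for $i\notin\mathcal J$ converges to $-\frac1{\|v_r\|_\infty}v_r$ as $t\to\infty$. -/

import Mathlib

open Filter Topology
open scoped Matrix

namespace OpinionDynamics

noncomputable section

/-- The spectral radius `ρ(A)` of a real square matrix: the largest modulus of its complex
eigenvalues. -/
def rho {N : ℕ} (A : Matrix (Fin N) (Fin N) ℝ) : ℝ :=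
  (spectralRadius ℂ (A.map (algebraMap ℝ ℂ))).toReal

/-- `A` is eventually positive: all sufficiently high powers are entrywise positive. -/
def EventuallyPositive {N : ℕ} (A : Matrix (Fin N) (Fin N) ℝ) : Prop :=
  ∃ k₀ : ℕ, 0 < k₀ ∧ ∀ k, k₀ ≤ k → ∀ i j, 0 < (A ^ k) i j

/-- The signed digraph with an edge `(i, j)` whenever `b i j ≠ 0` is strongly connected. -/
def StronglyConnected {N : ℕ} (B : Matrix (Fin N) (Fin N) ℝ) : Prop :=
  ∀ i j, Relation.ReflTransGen (fun a b => B a b ≠ 0) i j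

/-- The symmetric part `H(A) = (A + Aᵀ) / 2`. -/
def symPart {N : ℕ} (A : Matrix (Fin N) (Fin N) ℝ) : Matrix (Fin N) (Fin N) ℝ :=
  (1 / 2 : ℝ) • (A + Aᵀ)

/-- The system matrix `E = B - Σ`, where `Σ = diag σ`. -/
def sysMatrix {N : ℕ} (B : Matrix (Fin N) (Fin N) ℝ) (σ : Fin N → ℝ) :
    Matrix (Fin N) (Fin N) ℝ :=
  B - Matrix.diagonal σ

/-- First admissible case: `B` is eventually positive and the `σ i` have a common value
`d ≥ ρ(B)`. -/
def CaseB {N : ℕ} (B : Matrix (Fin N) (Fin N) ℝ) (σ : Fin N → ℝ) (d : ℝ) : Prop :=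
  EventuallyPositive B ∧ (∀ i, σ i = d) ∧ rho B ≤ d

/-- Second admissible case: `B` is not eventually positive, but `C = B + (d I - Σ)`, for which
`E = C - d I`, is eventually positive, and `d ≥ ρ(C)`. -/
def CaseC {N : ℕ} (B : Matrix (Fin N) (Fin N) ℝ) (σ : Fin N → ℝ)
    (C : Matrix (Fin N) (Fin N) ℝ) (d : ℝ) : Prop :=
  ¬ EventuallyPositive B ∧
    C = B + (d • (1 : Matrix (Fin N) (Fin N) ℝ) - Matrix.diagonal σ) ∧
    EventuallyPositive C ∧ rho C ≤ d

/-- `v` is an entrywise positive right eigenvector of `C`. -/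
def IsPositiveEigenvector {N : ℕ} (C : Matrix (Fin N) (Fin N) ℝ) (v : Fin N → ℝ) : Prop :=
  (∀ i, 0 < v i) ∧ ∃ μ : ℝ, Module.End.HasEigenvector (Matrix.toLin' C) μ v

/-- The stubborn extremists susceptibility `A(x) = I - diag(x)²`. -/
def susceptibility {N : ℕ} (x : Fin N → ℝ) : Matrix (Fin N) (Fin N) ℝ :=
  1 - Matrix.diagonal x ^ 2

/-- `x` solves `ẋ = A(x) E x` on `[0, ∞)`, with the one-sided derivative at `0`. -/
def IsSolution {N : ℕ} (E : Matrix (Fin N) (Fin N) ℝ) (x : ℝ → Fin N → ℝ) : Prop :=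
  ∀ t : ℝ, 0 ≤ t →
    HasDerivWithinAt x (susceptibility (x t) *ᵥ (E *ᵥ x t)) (Set.Ici 0) t

/-- The matrix `P E Pᵀ` obtained by the simultaneous row and column permutation that lists the
`k` indices `e (inl _)` first and the `m` indices `e (inr _)` last. -/
def permuted {N k m : ℕ} (E : Matrix (Fin N) (Fin N) ℝ) (e : Fin k ⊕ Fin m ≃ Fin N) :
    Matrix (Fin k ⊕ Fin m) (Fin k ⊕ Fin m) ℝ :=
  E.submatrix e e

/-- The vector `-Ē₂₂⁻¹ Ē₂₁ y₁`, where `Ē = P E Pᵀ`. -/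
def reducedEquilibrium {N k m : ℕ} (E : Matrix (Fin N) (Fin N) ℝ)
    (e : Fin k ⊕ Fin m ≃ Fin N) (y₁ : Fin k → ℝ) : Fin m → ℝ :=
  -((permuted E e).toBlocks₂₂⁻¹ *ᵥ ((permuted E e).toBlocks₂₁ *ᵥ y₁))

/-- The vector `Pᵀ (y₁, y₂)` in the original order of the indices. -/
def assemble {N k m : ℕ} (e : Fin k ⊕ Fin m ≃ Fin N) (y₁ : Fin k → ℝ) (y₂ : Fin m → ℝ) :
    Fin N → ℝ :=
  fun i => Sum.elim y₁ y₂ (e.symm i)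

end

end OpinionDynamics

open OpinionDynamics

namespace OpinionDynamics

/-! The susceptibility `1 - x i ^ 2` is exactly cancelled by the derivative `(s - y) / (1 - s ^ 2)`
of a two-point relative entropy. Suppose that the coordinates outside `S` are frozen at ±1 and that
`y`, on the same face, satisfies `(E y) i = 0` for `i ∈ S`. Then the `γ`-weighted entropy relative
to `y` has derivative `(x - y)ᵀ Γ E (x - y)` along solutions. This form is nonpositive, and by the
rank condition it vanishes only when `E (x - y) = 0`.

The core is `IsSolution.exists_tendsto`. Compactness of entropy sublevel sets gives a limit point
`z` inside the open face with `E (z - y) = 0`. Then `z` can replace `y` as reference point; the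
entropy relative to `z` is again nonincreasing and reaches its minimum along a subsequence, so the
whole solution converges to `z`.

It remains to identify `z` from `z - y ∈ ker E`. Perron–Frobenius theory for the eventually positive
`C`, with `d ≥ ρ(C)`, confines `ker E = ker (C - d I)` to the line spanned by `v`. With nothing
frozen, take `y = 0`. In the block case, nonsingularity of `Ē₂₂` forces `z = y`. In the critical
cases `y = ±v / ‖v‖`, and a multiple of `v` vanishing at one index is zero. -/

/-! ### The dissipation form and its kernel -/

lemma symPart_mulVec_dotProduct {N : ℕ} (A : Matrix (Fin N) (Fin N) ℝ) (w : Fin N → ℝ) :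
    w ⬝ᵥ symPart A *ᵥ w = w ⬝ᵥ A *ᵥ w := by
  have h : w ⬝ᵥ Aᵀ *ᵥ w = w ⬝ᵥ A *ᵥ w := by
    rw [Matrix.mulVec_transpose, dotProduct_comm, Matrix.dotProduct_mulVec]
  rw [symPart, Matrix.smul_mulVec, Matrix.add_mulVec, dotProduct_smul, dotProduct_add, h,
    smul_eq_mul]
  ring

lemma dotProduct_diagonal_mul_mulVec {N : ℕ} (E : Matrix (Fin N) (Fin N) ℝ) (γ w : Fin N → ℝ) :
    w ⬝ᵥ (Matrix.diagonal γ * E) *ᵥ w = ∑ i, γ i * (w i * (E *ᵥ w) i) := by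
  rw [← Matrix.mulVec_mulVec, dotProduct]
  refine Finset.sum_congr rfl fun i _ => ?_
  rw [Matrix.mulVec_diagonal]
  ring

lemma dissipation_nonpos {N : ℕ} {E : Matrix (Fin N) (Fin N) ℝ} {γ : Fin N → ℝ}
    (hneg : (-symPart (Matrix.diagonal γ * E)).PosSemidef) (w : Fin N → ℝ) :
    ∑ i, γ i * (w i * (E *ᵥ w) i) ≤ 0 := by
  have h := hneg.dotProduct_mulVec_nonneg w
  rw [star_trivial, Matrix.neg_mulVec, dotProduct_neg, symPart_mulVec_dotProduct,
    dotProduct_diagonal_mul_mulVec] at h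
  linarith

/-- A zero of a semidefinite form lies in the kernel of its matrix `H`. In particular `ker E ⊆ ker
H`, and equal ranks make the two kernels coincide. -/
lemma mulVec_eq_zero_of_dissipation_eq_zero {N : ℕ} {E : Matrix (Fin N) (Fin N) ℝ}
    {γ : Fin N → ℝ}
    (hneg : (-symPart (Matrix.diagonal γ * E)).PosSemidef)
    (hrank : (symPart (Matrix.diagonal γ * E)).rank = E.rank) {w : Fin N → ℝ}
    (hw : ∑ i, γ i * (w i * (E *ᵥ w) i) = 0) : E *ᵥ w = 0 := by
  set H := symPart (Matrix.diagonal γ * E) with hH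
  have key : ∀ u : Fin N → ℝ, ∑ i, γ i * (u i * (E *ᵥ u) i) = 0 → H *ᵥ u = 0 := by
    intro u hu
    have := (hneg.dotProduct_mulVec_zero_iff u).1 (by
      rw [star_trivial, Matrix.neg_mulVec, dotProduct_neg, symPart_mulVec_dotProduct,
        dotProduct_diagonal_mul_mulVec, hu, neg_zero])
    simpa [Matrix.neg_mulVec] using this
  have hle : LinearMap.ker E.mulVecLin ≤ LinearMap.ker H.mulVecLin := by
    intro u hu
    rw [LinearMap.mem_ker, Matrix.mulVecLin_apply] at hu ⊢
    exact key u (by simp [hu])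
  have heq : LinearMap.ker E.mulVecLin = LinearMap.ker H.mulVecLin := by
    refine Submodule.eq_of_le_of_finrank_eq hle ?_
    have h1 := LinearMap.finrank_range_add_finrank_ker E.mulVecLin
    have h2 := LinearMap.finrank_range_add_finrank_ker H.mulVecLin
    unfold Matrix.rank at hrank
    omega
  have : w ∈ LinearMap.ker H.mulVecLin := by
    rw [LinearMap.mem_ker, Matrix.mulVecLin_apply]
    exact key w hw
  rw [← heq, LinearMap.mem_ker, Matrix.mulVecLin_apply] at this
  exact this

/-! ### Perron–Frobenius theory for eventually positive matrices -/

lemma pow_mulVec_of_eigenvector {n R : Type*} [Fintype n] [DecidableEq n] [CommRing R]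
    {A : Matrix n n R} {v : n → R} {μ : R} (h : A *ᵥ v = μ • v) (k : ℕ) :
    A ^ k *ᵥ v = μ ^ k • v := by
  induction k with
  | zero => simp
  | succ k ih => rw [pow_succ, ← Matrix.mulVec_mulVec, h, Matrix.mulVec_smul, ih, smul_smul,
      pow_succ, mul_comm]

section PerronFrobenius

variable {N : ℕ} {C : Matrix (Fin N) (Fin N) ℝ} {v : Fin N → ℝ} {μ : ℝ}

/-- Entries of `C` may be negative, so only high powers are usable: two consecutive powers of `μ`
are positive, hence so is their ratio. -/
lemma EventuallyPositive.eigenvalue_pos (hN : 0 < N) (hC : EventuallyPositive C)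
    (hv : ∀ i, 0 < v i) (h : C *ᵥ v = μ • v) : 0 < μ := by
  obtain ⟨k, -, hk⟩ := hC
  have hne : (Finset.univ : Finset (Fin N)).Nonempty := ⟨⟨0, hN⟩, Finset.mem_univ _⟩
  have hpos : ∀ l, k ≤ l → 0 < μ ^ l := by
    intro l hl
    have h1 := congrFun (pow_mulVec_of_eigenvector h l) ⟨0, hN⟩
    have h2 : 0 < (C ^ l *ᵥ v) ⟨0, hN⟩ :=
      Finset.sum_pos (fun j _ => mul_pos (hk l hl _ j) (hv j)) hne
    rw [h1, Pi.smul_apply, smul_eq_mul] at h2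
    exact pos_of_mul_pos_left h2 (hv _).le
  have h1 := hpos k le_rfl
  have h2 := hpos (k + 1) (Nat.le_succ k)
  rw [pow_succ] at h2
  exact pos_of_mul_pos_right h2 h1.le

/-- In the weighted sup norm `max ‖w i‖ / v i`, the positive matrix `C ^ k` has norm `μ ^ k`,
because it maps `v` to `μ ^ k • v`. Comparing at a maximising index gives `‖z‖ ^ k ≤ μ ^ k`. -/
lemma EventuallyPositive.norm_eigenvalue_le (hN : 0 < N) (hC : EventuallyPositive C)
    (hv : ∀ i, 0 < v i) (h : C *ᵥ v = μ • v) {w : Fin N → ℂ} {z : ℂ} (hw : w ≠ 0)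
    (hz : C.map (algebraMap ℝ ℂ) *ᵥ w = z • w) : ‖z‖ ≤ μ := by
  have hμ := hC.eigenvalue_pos hN hv h
  obtain ⟨k, hk0, hk⟩ := hC
  have : Nonempty (Fin N) := ⟨⟨0, hN⟩⟩
  obtain ⟨i, hi⟩ := Finite.exists_max fun i => ‖w i‖ / v i
  set r := ‖w i‖ / v i with hr
  have hle : ∀ j, ‖w j‖ ≤ r * v j := fun j => (div_le_iff₀ (hv j)).1 (hi j)
  have hrpos : 0 < r := by
    obtain ⟨j, hj⟩ := Function.ne_iff.1 hw
    exact pos_of_mul_pos_left ((norm_pos_iff.2 hj).trans_le (hle j)) (hv j).le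
  have h1 := congrFun (pow_mulVec_of_eigenvector hz k) i
  have h2 : ‖z‖ ^ k * (r * v i) ≤ μ ^ k * (r * v i) := by
    calc ‖z‖ ^ k * (r * v i) = ‖(z ^ k • w) i‖ := by
          rw [Pi.smul_apply, smul_eq_mul, norm_mul, norm_pow, hr, div_mul_cancel₀ _ (hv i).ne']
      _ = ‖∑ j, ((C ^ k) i j : ℂ) * w j‖ := by
          rw [← h1, ← Matrix.map_pow]; rfl
      _ ≤ ∑ j, (C ^ k) i j * (r * v j) := by
          refine (norm_sum_le _ _).trans (Finset.sum_le_sum fun j _ => ?_)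
          rw [norm_mul, Complex.norm_real, Real.norm_of_nonneg (hk k le_rfl i j).le]
          exact mul_le_mul_of_nonneg_left (hle j) (hk k le_rfl i j).le
      _ = r * (C ^ k *ᵥ v) i := by
          rw [Matrix.mulVec, dotProduct, Finset.mul_sum]
          exact Finset.sum_congr rfl fun j _ => by ring
      _ = μ ^ k * (r * v i) := by
          rw [pow_mulVec_of_eigenvector h k, Pi.smul_apply, smul_eq_mul]; ring
  exact le_of_pow_le_pow_left₀ hk0.ne' hμ.le
    (le_of_mul_le_mul_right h2 (mul_pos hrpos (hv i)))

lemma map_mulVec_ofReal (A : Matrix (Fin N) (Fin N) ℝ) (w : Fin N → ℝ) :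
    A.map (algebraMap ℝ ℂ) *ᵥ (fun i => (w i : ℂ)) = fun i => ((A *ᵥ w) i : ℂ) := by
  ext i
  simp [Matrix.mulVec, dotProduct]

lemma EventuallyPositive.rho_eq (hN : 0 < N) (hC : EventuallyPositive C)
    (hv : ∀ i, 0 < v i) (h : C *ᵥ v = μ • v) : rho C = μ := by
  have hμ := hC.eigenvalue_pos hN hv h
  have hmem : ∀ z : ℂ, z ∈ spectrum ℂ (C.map (algebraMap ℝ ℂ)) ↔
      ∃ w : Fin N → ℂ, w ≠ 0 ∧ C.map (algebraMap ℝ ℂ) *ᵥ w = z • w := by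
    intro z
    rw [← Matrix.spectrum_toLin', ← Module.End.hasEigenvalue_iff_mem_spectrum]
    constructor
    · intro hz
      obtain ⟨w, hw⟩ := hz.exists_hasEigenvector
      exact ⟨w, hw.2, by simpa using hw.apply_eq_smul⟩
    · rintro ⟨w, hw, hw'⟩
      exact Module.End.hasEigenvalue_of_hasEigenvector
        (x := w) ⟨Module.End.mem_eigenspace_iff.2 (by simpa using hw'), hw⟩
  have hs : spectralRadius ℂ (C.map (algebraMap ℝ ℂ)) = ENNReal.ofReal μ := by
    refine le_antisymm (iSup₂_le fun z hz => ?_) ?_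
    · obtain ⟨w, hw, hw'⟩ := (hmem z).1 hz
      rw [← ENNReal.ofReal_coe_nnreal, coe_nnnorm]
      exact ENNReal.ofReal_le_ofReal (hC.norm_eigenvalue_le hN hv h hw hw')
    · have : (μ : ℂ) ∈ spectrum ℂ (C.map (algebraMap ℝ ℂ)) := by
        refine (hmem _).2 ⟨fun i => (v i : ℂ), ?_, ?_⟩
        · intro h0
          have := congrFun h0 ⟨0, hN⟩
          exact (hv ⟨0, hN⟩).ne' (by simpa using this)
        · rw [map_mulVec_ofReal, h]
          ext i
          simp
      have h2 := le_iSup₂ (f := fun (k : ℂ) (_ : k ∈ spectrum ℂ (C.map (algebraMap ℝ ℂ))) =>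
        (‖k‖₊ : ENNReal)) _ this
      refine le_trans (le_of_eq ?_) h2
      rw [← ENNReal.ofReal_coe_nnreal, coe_nnnorm, Complex.norm_real, Real.norm_of_nonneg hμ.le]
  rw [rho, hs, ENNReal.toReal_ofReal hμ.le]

/-- Subtract from `w` the largest multiple of `v` lying below it. The difference is a nonnegative
eigenvector with a zero coordinate; the corresponding row of `C ^ k` is strictly positive, so every
coordinate vanishes. -/
lemma EventuallyPositive.eigenvector_unique (hN : 0 < N) (hC : EventuallyPositive C)
    (hv : ∀ i, 0 < v i) (h : C *ᵥ v = μ • v) {w : Fin N → ℝ} (hw : C *ᵥ w = μ • w) :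
    ∃ α : ℝ, w = α • v := by
  have hμ := hC.eigenvalue_pos hN hv h
  obtain ⟨k, hk0, hk⟩ := hC
  have : Nonempty (Fin N) := ⟨⟨0, hN⟩⟩
  obtain ⟨i, hi⟩ := Finite.exists_min fun i => w i / v i
  refine ⟨w i / v i, ?_⟩
  set r := w i / v i with hr
  have hnn : ∀ j, 0 ≤ w j - r * v j := fun j => by
    have := (le_div_iff₀ (hv j)).1 (hi j)
    linarith
  have hu : C *ᵥ (w - r • v) = μ • (w - r • v) := by
    rw [Matrix.mulVec_sub, Matrix.mulVec_smul, h, hw, smul_sub, smul_comm]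
  have h1 := congrFun (pow_mulVec_of_eigenvector hu k) i
  have h2 : (μ ^ k • (w - r • v)) i = 0 := by
    simp [hr, div_mul_cancel₀ _ (hv i).ne']
  rw [h2, Matrix.mulVec, dotProduct, Finset.sum_eq_zero_iff_of_nonneg
    (fun j _ => mul_nonneg (hk k le_rfl i j).le (by simpa using hnn j))] at h1
  ext j
  have h3 := (mul_eq_zero.1 (h1 j (Finset.mem_univ j))).resolve_left (hk k le_rfl i j).ne'
  simpa [sub_eq_zero] using h3

lemma IsPositiveEigenvector.mulVec_eq (hN : 0 < N) (hC : EventuallyPositive C)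
    (hv : IsPositiveEigenvector C v) : C *ᵥ v = rho C • v := by
  obtain ⟨hpos, μ, hμ⟩ := hv
  have h : C *ᵥ v = μ • v := by simpa using hμ.apply_eq_smul
  rw [hC.rho_eq hN hpos h, h]

/-- A nonzero `w` makes `d` an eigenvalue, so `|d| ≤ ρ(C) ≤ d`; thus `d = ρ(C)` and uniqueness
applies. If `d > ρ(C)`, only `w = 0` is possible. -/
lemma IsPositiveEigenvector.eq_smul_of_mulVec_eq (hN : 0 < N) (hC : EventuallyPositive C)
    (hv : IsPositiveEigenvector C v) {d : ℝ} (hd : rho C ≤ d) {w : Fin N → ℝ}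
    (hw : C *ᵥ w = d • w) : ∃ α : ℝ, w = α • v := by
  by_cases hw0 : w = 0
  · exact ⟨0, by simp [hw0]⟩
  have hv' := hv.mulVec_eq hN hC
  have hle := hC.norm_eigenvalue_le hN hv.1 hv' (w := fun i => (w i : ℂ)) (z := d)
    (fun h => hw0 (funext fun i => by simpa using congrFun h i))
    (by rw [map_mulVec_ofReal, hw]; ext i; simp)
  rw [Complex.norm_real, Real.norm_eq_abs] at hle
  have : d = rho C := le_antisymm ((le_abs_self d).trans hle) hd
  exact hC.eigenvector_unique hN hv.1 hv' (this ▸ hw)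

end PerronFrobenius

/-! ### The scalar entropy -/

/-- Up to a constant, the relative entropy between two-point distributions with means `y`
and `s`. -/
noncomputable def entropy (y s : ℝ) : ℝ :=
  -((1 - y) / 2 * Real.log (1 - s)) - (1 + y) / 2 * Real.log (1 + s)

lemma hasDerivAt_entropy (y : ℝ) {s : ℝ} (hs : s ∈ Set.Ioo (-1 : ℝ) 1) :
    HasDerivAt (entropy y) ((s - y) / (1 - s ^ 2)) s := by
  have h1 : 1 - s ≠ 0 := by linarith [hs.2]
  have h2 : 1 + s ≠ 0 := by linarith [hs.1]
  have h3 : 1 - s ^ 2 ≠ 0 := by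
    rw [show 1 - s ^ 2 = (1 - s) * (1 + s) by ring]; exact mul_ne_zero h1 h2
  have d1 := (((hasDerivAt_id s).const_sub 1).log h1).const_mul ((1 - y) / 2)
  have d2 := (((hasDerivAt_id s).const_add 1).log h2).const_mul ((1 + y) / 2)
  refine (d1.neg.sub d2).congr_deriv ?_
  simp only [id]
  rw [show 1 - s ^ 2 = (1 - s) * (1 + s) by ring]
  field_simp
  ring

/-- The entropy minus `(r - y) ^ 2 / 2` has derivative `(r - y) * r ^ 2 / (1 - r ^ 2)`, which
changes sign only at `y`, so its minimum is there. -/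
lemma sq_le_entropy_sub {y s : ℝ} (hy : y ∈ Set.Ioo (-1 : ℝ) 1) (hs : s ∈ Set.Ioo (-1 : ℝ) 1) :
    (s - y) ^ 2 / 2 ≤ entropy y s - entropy y y := by
  have hd : ∀ r ∈ Set.Ioo (-1 : ℝ) 1,
      HasDerivAt (fun r => entropy y r - (r - y) ^ 2 / 2) ((r - y) * (r ^ 2 / (1 - r ^ 2))) r := by
    intro r hr
    have h3 : 0 < 1 - r ^ 2 := by nlinarith [hr.1, hr.2]
    refine ((hasDerivAt_entropy y hr).sub
      ((((hasDerivAt_id r).sub_const y).pow 2).div_const 2)).congr_deriv ?_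
    simp only [id]
    field_simp
    ring
  have hnn : ∀ r ∈ Set.Ioo (-1 : ℝ) 1, 0 ≤ r ^ 2 / (1 - r ^ 2) := fun r hr =>
    div_nonneg (sq_nonneg r) (by nlinarith [hr.1, hr.2])
  rcases le_total y s with h | h
  · have hsub : Set.Icc y s ⊆ Set.Ioo (-1 : ℝ) 1 := fun r hr =>
      ⟨hy.1.trans_le hr.1, hr.2.trans_lt hs.2⟩
    have hm : MonotoneOn (fun r => entropy y r - (r - y) ^ 2 / 2) (Set.Icc y s) := by
      refine monotoneOn_of_deriv_nonneg (convex_Icc y s)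
        (fun r hr => (hd r (hsub hr)).continuousAt.continuousWithinAt)
        (fun r hr => (hd r (hsub (interior_subset hr))).differentiableAt.differentiableWithinAt)
        (fun r hr => ?_)
      have hr := interior_subset hr
      rw [(hd r (hsub hr)).deriv]
      exact mul_nonneg (sub_nonneg.2 hr.1) (hnn r (hsub hr))
    have := hm (Set.left_mem_Icc.2 h) (Set.right_mem_Icc.2 h) h
    simp only [sub_self] at this
    linarith
  · have hsub : Set.Icc s y ⊆ Set.Ioo (-1 : ℝ) 1 := fun r hr =>
      ⟨hs.1.trans_le hr.1, hr.2.trans_lt hy.2⟩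
    have hm : AntitoneOn (fun r => entropy y r - (r - y) ^ 2 / 2) (Set.Icc s y) := by
      refine antitoneOn_of_deriv_nonpos (convex_Icc s y)
        (fun r hr => (hd r (hsub hr)).continuousAt.continuousWithinAt)
        (fun r hr => (hd r (hsub (interior_subset hr))).differentiableAt.differentiableWithinAt)
        (fun r hr => ?_)
      have hr := interior_subset hr
      rw [(hd r (hsub hr)).deriv]
      exact mul_nonpos_of_nonpos_of_nonneg (sub_nonpos.2 hr.2) (hnn r (hsub hr))
    have := hm (Set.left_mem_Icc.2 h) (Set.right_mem_Icc.2 h) h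
    simp only [sub_self] at this
    linarith

/-- Both logarithms carry positive weights since `y` is interior, so the entropy blows up at both
ends. The lower end follows from the upper one by `s ↦ -s`. -/
lemma exists_abs_le_of_entropy_le {y : ℝ} (hy : y ∈ Set.Ioo (-1 : ℝ) 1) (K : ℝ) :
    ∃ r < 1, ∀ s ∈ Set.Ioo (-1 : ℝ) 1, entropy y s ≤ K → |s| ≤ r := by
  have hl2 : 0 < Real.log 2 := Real.log_pos (by norm_num)
  have key : ∀ a ∈ Set.Ioo (0 : ℝ) 1, ∃ r < 1, ∀ s ∈ Set.Ioo (-1 : ℝ) 1,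
      -(a * Real.log (1 - s)) ≤ K + (1 - a) * Real.log (1 + s) → s ≤ r := by
    intro a ha
    -- Bounding `(1 - a) * log (1 + s)` by `log 2` leaves `-log (1 - s) ≤ (K + log 2) / a`; this is
    -- solved for `s`.
    refine ⟨1 - Real.exp (-((K + Real.log 2) / a)) ⊓ 1, ?_, fun s hs h => ?_⟩
    · have := lt_min (Real.exp_pos (-((K + Real.log 2) / a))) one_pos
      linarith
    have h1 : 0 < 1 - s := by linarith [hs.2]
    have h2 : Real.log (1 + s) ≤ Real.log 2 :=
      Real.log_le_log (by linarith [hs.1]) (by linarith [hs.2])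
    have h3 : -Real.log (1 - s) ≤ (K + Real.log 2) / a := by
      rw [le_div_iff₀ ha.1]
      nlinarith [ha.1, ha.2]
    have h4 : Real.exp (-((K + Real.log 2) / a)) ≤ 1 - s := by
      rw [← Real.le_log_iff_exp_le h1]
      linarith
    have := (min_le_left (Real.exp (-((K + Real.log 2) / a))) 1).trans h4
    linarith
  obtain ⟨r₁, hr₁, h₁⟩ := key ((1 - y) / 2) ⟨by linarith [hy.2], by linarith [hy.1]⟩
  obtain ⟨r₂, hr₂, h₂⟩ := key ((1 + y) / 2) ⟨by linarith [hy.1], by linarith [hy.2]⟩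
  refine ⟨max r₁ r₂, max_lt hr₁ hr₂, fun s hs h => abs_le'.2 ⟨?_, ?_⟩⟩
  · refine (h₁ s hs ?_).trans (le_max_left _ _)
    unfold entropy at h
    rw [show 1 - (1 - y) / 2 = (1 + y) / 2 by ring]
    linarith
  · refine (h₂ (-s) ⟨by linarith [hs.2], by linarith [hs.1]⟩ ?_).trans (le_max_right _ _)
    unfold entropy at h
    rw [show 1 - (1 + y) / 2 = (1 - y) / 2 by ring, sub_neg_eq_add, ← sub_eq_add_neg]
    linarith

/-! ### Invariance of the open cube and its faces -/

/-- A solution of a scalar linear equation is its initial value times an exponential. -/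
lemma exists_eq_mul_exp_of_linear {w a : ℝ → ℝ} (ha : ContinuousOn a (Set.Ici 0))
    (hw : ∀ t, 0 ≤ t → HasDerivWithinAt w (a t * w t) (Set.Ici 0) t) :
    ∃ A : ℝ → ℝ, ∀ t, 0 ≤ t → w t = w 0 * Real.exp (A t) := by
  -- Extending `a` by the constant `a 0` to negative times makes the integral differentiable at `0`
  -- as well.
  set b : ℝ → ℝ := fun t => a (max t 0) with hb
  have hbc : Continuous b := ha.comp_continuous (by fun_prop) (fun t => le_max_right t 0)
  set A : ℝ → ℝ := fun t => ∫ s in (0 : ℝ)..t, b s with hA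
  have hAd : ∀ t, HasDerivAt A (b t) t := fun t => (hbc.integral_hasStrictDerivAt 0 t).hasDerivAt
  have hd : ∀ t, 0 ≤ t →
      HasDerivWithinAt (fun t => w t * Real.exp (-A t)) 0 (Set.Ici 0) t := by
    intro t ht
    refine ((hw t ht).mul (hAd t).neg.exp.hasDerivWithinAt).congr_deriv ?_
    simp only [hb, max_eq_left ht]
    ring
  refine ⟨A, fun t ht => ?_⟩
  have hc := constant_of_has_deriv_right_zero (f := fun t => w t * Real.exp (-A t)) (a := 0)
    (b := t) (fun s hs => (hd s hs.1).continuousWithinAt.mono Set.Icc_subset_Ici_self)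
    (fun s hs => (hd s hs.1).mono (Set.Ici_subset_Ici.2 hs.1)) t (Set.right_mem_Icc.2 ht)
  have hA0 : A 0 = 0 := intervalIntegral.integral_same
  simp only [hA0, neg_zero, Real.exp_zero, mul_one] at hc
  rw [← hc, mul_assoc, ← Real.exp_add, neg_add_cancel, Real.exp_zero, mul_one]

section Solutions

variable {N : ℕ} {E : Matrix (Fin N) (Fin N) ℝ} {x : ℝ → Fin N → ℝ}

lemma IsSolution.hasDerivWithinAt_apply (hx : IsSolution E x) {t : ℝ} (ht : 0 ≤ t) (i : Fin N) :
    HasDerivWithinAt (fun t => x t i) ((1 - x t i ^ 2) * (E *ᵥ x t) i) (Set.Ici 0) t := by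
  refine (hasDerivWithinAt_pi.1 (hx t ht) i).congr_deriv ?_
  rw [susceptibility, Matrix.diagonal_pow, Matrix.sub_mulVec, Matrix.one_mulVec, Pi.sub_apply,
    Matrix.mulVec_diagonal, Pi.pow_apply]
  ring

lemma IsSolution.continuousOn (hx : IsSolution E x) : ContinuousOn x (Set.Ici 0) :=
  fun t ht => (hx t ht).continuousWithinAt

/-- Along a solution, `1 - x i ^ 2` obeys a scalar linear equation, so it keeps its sign or stays
zero. Interior coordinates therefore remain interior and coordinates at ±1 remain frozen, with no
appeal to uniqueness of solutions. -/
lemma IsSolution.exists_one_sub_sq_eq (hx : IsSolution E x) (i : Fin N) :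
    ∃ A : ℝ → ℝ, ∀ t, 0 ≤ t → 1 - x t i ^ 2 = (1 - x 0 i ^ 2) * Real.exp (A t) := by
  refine exists_eq_mul_exp_of_linear (w := fun t => 1 - x t i ^ 2)
    (a := fun t => -2 * x t i * (E *ᵥ x t) i) ?_ fun t ht => ?_
  · have h1 : Continuous fun u : Fin N → ℝ => -2 * u i * (E *ᵥ u) i := by
      have := (Continuous.matrix_mulVec (continuous_const (y := E)) continuous_id)
      exact (by fun_prop : Continuous fun u : Fin N → ℝ => -2 * u i).mul
        ((continuous_apply i).comp this)
    exact h1.comp_continuousOn hx.continuousOn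
  · refine (((hx.hasDerivWithinAt_apply ht i).pow 2).const_sub 1).congr_deriv ?_
    push_cast
    ring

lemma IsSolution.apply_mem_Ioo (hx : IsSolution E x) {i : Fin N}
    (h0 : x 0 i ∈ Set.Ioo (-1 : ℝ) 1) {t : ℝ} (ht : 0 ≤ t) : x t i ∈ Set.Ioo (-1 : ℝ) 1 := by
  obtain ⟨A, hA⟩ := hx.exists_one_sub_sq_eq i
  have h1 : 0 < 1 - x t i ^ 2 := by
    rw [hA t ht]
    exact mul_pos (by nlinarith [h0.1, h0.2]) (Real.exp_pos _)
  exact abs_lt.1 (by rw [← sq_lt_one_iff_abs_lt_one]; linarith)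

lemma IsSolution.apply_eq_of_abs_eq_one (hx : IsSolution E x) {i : Fin N}
    (h0 : |x 0 i| = 1) {t : ℝ} (ht : 0 ≤ t) : x t i = x 0 i := by
  obtain ⟨A, hA⟩ := hx.exists_one_sub_sq_eq i
  have h1 : ∀ s, 0 ≤ s → 1 - x s i ^ 2 = 0 := by
    intro s hs
    rw [hA s hs, ← sq_abs, h0]
    simp
  refine constant_of_has_deriv_right_zero (f := fun t => x t i) (a := 0) (b := t)
    (fun s hs => (hx.hasDerivWithinAt_apply hs.1 i).continuousWithinAt.mono
      Set.Icc_subset_Ici_self)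
    (fun s hs => ?_) t (Set.right_mem_Icc.2 ht)
  refine ((hx.hasDerivWithinAt_apply hs.1 i).mono (Set.Ici_subset_Ici.2 hs.1)).congr_deriv ?_
  rw [h1 s hs.1, zero_mul]

end Solutions

/-! ### The Lyapunov function -/

/-- The weighted entropy relative to `y` of the coordinates in `S`. -/
noncomputable def lyapunov {N : ℕ} (γ : Fin N → ℝ) (S : Finset (Fin N)) (y x : Fin N → ℝ) : ℝ :=
  ∑ i ∈ S, γ i * entropy (y i) (x i)

section Lyapunov

variable {N : ℕ} {E : Matrix (Fin N) (Fin N) ℝ} {x : ℝ → Fin N → ℝ} {γ y : Fin N → ℝ}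
  {S : Finset (Fin N)}

lemma continuousAt_lyapunov {u : Fin N → ℝ} (hu : ∀ i ∈ S, u i ∈ Set.Ioo (-1 : ℝ) 1) :
    ContinuousAt (lyapunov γ S y) u := by
  unfold lyapunov
  refine tendsto_finsetSum _ fun i hi => ?_
  exact (ContinuousAt.comp (f := fun x : Fin N → ℝ => x i)
    (hasDerivAt_entropy (y i) (hu i hi)).continuousAt
    (continuous_apply i).continuousAt).const_mul (γ i)

/-- After cancellation of `1 - x i ^ 2`, the condition `(E y) i = 0` on `S` allows `E x` to be
replaced by `E (x - y)`. Off `S` the factor `x i - y i` is zero, so the sum over `S` is the full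
quadratic form. -/
lemma IsSolution.hasDerivWithinAt_lyapunov (hx : IsSolution E x)
    (h0 : ∀ i ∈ S, x 0 i ∈ Set.Ioo (-1 : ℝ) 1) (hface : ∀ i ∉ S, |x 0 i| = 1 ∧ x 0 i = y i)
    (hEy : ∀ i ∈ S, (E *ᵥ y) i = 0) {t : ℝ} (ht : 0 ≤ t) :
    HasDerivWithinAt (fun t => lyapunov γ S y (x t))
      (∑ i, γ i * ((x t - y) i * (E *ᵥ (x t - y)) i)) (Set.Ici 0) t := by
  have hsum : ∑ i, γ i * ((x t - y) i * (E *ᵥ (x t - y)) i) =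
      ∑ i ∈ S, γ i * ((x t i - y i) / (1 - x t i ^ 2) * ((1 - x t i ^ 2) * (E *ᵥ x t) i)) := by
    rw [← Finset.sum_subset (Finset.subset_univ S)]
    · refine Finset.sum_congr rfl fun i hi => ?_
      have hxi := hx.apply_mem_Ioo (h0 i hi) ht
      have h1 : 1 - x t i ^ 2 ≠ 0 := by nlinarith [hxi.1, hxi.2]
      rw [Matrix.mulVec_sub, Pi.sub_apply, Pi.sub_apply, hEy i hi]
      field_simp
      ring
    · intro i _ hi
      rw [Pi.sub_apply, hx.apply_eq_of_abs_eq_one (hface i hi).1 ht, (hface i hi).2]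
      ring
  rw [hsum]
  unfold lyapunov
  refine HasDerivWithinAt.fun_sum fun i hi => ?_
  exact ((hasDerivAt_entropy (y i) (hx.apply_mem_Ioo (h0 i hi) ht)).comp_hasDerivWithinAt t
    (hx.hasDerivWithinAt_apply ht i)).const_mul (γ i)

/-- Used with `c = 0` for monotonicity and with `c = -ε` to rule out persistent dissipation. -/
lemma IsSolution.lyapunov_sub_le (hx : IsSolution E x)
    (h0 : ∀ i ∈ S, x 0 i ∈ Set.Ioo (-1 : ℝ) 1) (hface : ∀ i ∉ S, |x 0 i| = 1 ∧ x 0 i = y i)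
    (hEy : ∀ i ∈ S, (E *ᵥ y) i = 0) {s t c : ℝ} (hs : 0 ≤ s) (hst : s ≤ t)
    (hc : ∀ r, s ≤ r → ∑ i, γ i * ((x r - y) i * (E *ᵥ (x r - y)) i) ≤ c) :
    lyapunov γ S y (x t) - lyapunov γ S y (x s) ≤ c * (t - s) := by
  have hd : ∀ r : ℝ, 0 ≤ r → _ := fun r hr =>
    hx.hasDerivWithinAt_lyapunov (γ := γ) h0 hface hEy hr
  have hd' : ∀ r ∈ interior (Set.Icc s t), _ := fun r hr => by
    rw [interior_Icc] at hr
    exact (hd r (hs.trans hr.1.le)).hasDerivAt (Ici_mem_nhds (hs.trans_lt hr.1))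
  refine (convex_Icc s t).image_sub_le_mul_sub_of_deriv_le
    (f := fun t => lyapunov γ S y (x t))
    (fun r hr => (hd r (hs.trans hr.1)).continuousWithinAt.mono
      fun q hq => hs.trans hq.1)
    (fun r hr => (hd' r hr).differentiableAt.differentiableWithinAt)
    (fun r hr => ?_) s (Set.left_mem_Icc.2 hst) t (Set.right_mem_Icc.2 hst) hst
  rw [(hd' r hr).deriv]
  exact hc r (interior_subset hr).1

lemma sq_le_lyapunov_sub (hγ : ∀ i, 0 < γ i) (hy : ∀ i ∈ S, y i ∈ Set.Ioo (-1 : ℝ) 1)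
    {u : Fin N → ℝ} (hu : ∀ i ∈ S, u i ∈ Set.Ioo (-1 : ℝ) 1) {i : Fin N} (hi : i ∈ S) :
    γ i * ((u i - y i) ^ 2 / 2) ≤ lyapunov γ S y u - lyapunov γ S y y := by
  unfold lyapunov
  rw [← Finset.sum_sub_distrib]
  have hle : ∀ j ∈ S, γ j * ((u j - y j) ^ 2 / 2) ≤
      γ j * entropy (y j) (u j) - γ j * entropy (y j) (y j) := fun j hj => by
    rw [← mul_sub]
    exact mul_le_mul_of_nonneg_left (sq_le_entropy_sub (hy j hj) (hu j hj)) (hγ j).le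
  exact (hle i hi).trans (Finset.single_le_sum (f := fun j => γ j * entropy (y j) (u j) -
    γ j * entropy (y j) (y j)) (fun j hj => le_trans
      (mul_nonneg (hγ j).le (by positivity)) (hle j hj)) hi)

lemma exists_abs_le_of_lyapunov_le (hγ : ∀ i, 0 < γ i) (hy : ∀ i ∈ S, y i ∈ Set.Ioo (-1 : ℝ) 1)
    (K : ℝ) : ∀ i ∈ S, ∃ r < 1, ∀ u : Fin N → ℝ, (∀ j ∈ S, u j ∈ Set.Ioo (-1 : ℝ) 1) →
      lyapunov γ S y u ≤ K → |u i| ≤ r := by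
  intro i hi
  obtain ⟨r, hr, h⟩ := exists_abs_le_of_entropy_le (hy i hi)
    (entropy (y i) (y i) + (K - lyapunov γ S y y) / γ i)
  refine ⟨r, hr, fun u hu hK => h (u i) (hu i hi) ?_⟩
  have hle : ∀ j ∈ S, 0 ≤ γ j * entropy (y j) (u j) - γ j * entropy (y j) (y j) := fun j hj => by
    rw [← mul_sub]
    exact mul_nonneg (hγ j).le ((by positivity : (0 : ℝ) ≤ _).trans
      (sq_le_entropy_sub (hy j hj) (hu j hj)))
  have h1 := Finset.single_le_sum (f := fun j => γ j * entropy (y j) (u j) -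
    γ j * entropy (y j) (y j)) hle hi
  rw [Finset.sum_sub_distrib] at h1
  change _ ≤ lyapunov γ S y u - lyapunov γ S y y at h1
  rw [← sub_le_iff_le_add', le_div_iff₀ (hγ i)]
  linarith

end Lyapunov

/-! ### Convergence inside a face -/

section Convergence

variable {N : ℕ} {E : Matrix (Fin N) (Fin N) ℝ} {x : ℝ → Fin N → ℝ} {γ y : Fin N → ℝ}
  {S : Finset (Fin N)}

lemma lyapunov_self_le (hγ : ∀ i, 0 < γ i) (hy : ∀ i ∈ S, y i ∈ Set.Ioo (-1 : ℝ) 1)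
    {u : Fin N → ℝ} (hu : ∀ i ∈ S, u i ∈ Set.Ioo (-1 : ℝ) 1) :
    lyapunov γ S y y ≤ lyapunov γ S y u :=
  Finset.sum_le_sum fun i hi => mul_le_mul_of_nonneg_left
    (sub_nonneg.1 ((by positivity : (0 : ℝ) ≤ _).trans (sq_le_entropy_sub (hy i hi) (hu i hi))))
    (hγ i).le

lemma continuous_dissipation (E : Matrix (Fin N) (Fin N) ℝ) (γ y : Fin N → ℝ) :
    Continuous fun u : Fin N → ℝ => ∑ i, γ i * ((u - y) i * (E *ᵥ (u - y)) i) := by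
  have h1 : Continuous fun u : Fin N → ℝ => E *ᵥ (u - y) :=
    continuous_const.matrix_mulVec (continuous_id.sub continuous_const)
  refine continuous_finsetSum _ fun i _ => continuous_const.mul (Continuous.mul ?_ ?_)
  · exact (continuous_apply i).comp (continuous_id.sub continuous_const)
  · exact (continuous_apply i).comp h1

lemma IsSolution.exists_dissipation_gt (hx : IsSolution E x) (hγ : ∀ i, 0 < γ i)
    (hy : ∀ i ∈ S, y i ∈ Set.Ioo (-1 : ℝ) 1)
    (h0 : ∀ i ∈ S, x 0 i ∈ Set.Ioo (-1 : ℝ) 1) (hface : ∀ i ∉ S, |x 0 i| = 1 ∧ x 0 i = y i)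
    (hEy : ∀ i ∈ S, (E *ᵥ y) i = 0) {T ε : ℝ} (hT : 0 ≤ T) (hε : 0 < ε) :
    ∃ t, T ≤ t ∧ -ε < ∑ i, γ i * ((x t - y) i * (E *ᵥ (x t - y)) i) := by
  by_contra! hcon
  have hlow : ∀ t, 0 ≤ t → lyapunov γ S y y ≤ lyapunov γ S y (x t) := fun t ht =>
    lyapunov_self_le hγ hy fun i hi => hx.apply_mem_Ioo (h0 i hi) ht
  set D := lyapunov γ S y (x T) - lyapunov γ S y y with hD
  have hDnn : 0 ≤ D := sub_nonneg.2 (hlow T hT)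
  -- Decay at rate `ε` for time `(D + 1) / ε` would cost `D + 1`, more than the excess `D` over the
  -- minimum.
  have hst : T ≤ T + (D + 1) / ε := le_add_of_nonneg_right (by positivity)
  have h1 := hx.lyapunov_sub_le (γ := γ) h0 hface hEy hT hst hcon
  have h2 := hlow _ (hT.trans hst)
  have h3 : -ε * (T + (D + 1) / ε - T) = -(D + 1) := by field_simp; ring
  rw [h3] at h1
  linarith

/-- A solution whose coordinates off `S` are frozen at `±1` converges inside its face, provided
the face contains an equilibrium `y` of the coordinates in `S`. -/
theorem IsSolution.exists_tendsto (hx : IsSolution E x) (hγ : ∀ i, 0 < γ i)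
    (hneg : ∀ w : Fin N → ℝ, ∑ i, γ i * (w i * (E *ᵥ w) i) ≤ 0)
    (hker : ∀ w : Fin N → ℝ, ∑ i, γ i * (w i * (E *ᵥ w) i) = 0 → E *ᵥ w = 0)
    (hy : ∀ i ∈ S, y i ∈ Set.Ioo (-1 : ℝ) 1)
    (h0 : ∀ i ∈ S, x 0 i ∈ Set.Ioo (-1 : ℝ) 1) (hface : ∀ i ∉ S, |x 0 i| = 1 ∧ x 0 i = y i)
    (hEy : ∀ i ∈ S, (E *ᵥ y) i = 0) :
    ∃ z, (∀ i ∈ S, z i ∈ Set.Ioo (-1 : ℝ) 1) ∧ (∀ i ∉ S, z i = y i) ∧ E *ᵥ (z - y) = 0 ∧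
      Tendsto x atTop (𝓝 z) := by
  classical
  have hin : ∀ t, 0 ≤ t → ∀ i ∈ S, x t i ∈ Set.Ioo (-1 : ℝ) 1 := fun t ht i hi =>
    hx.apply_mem_Ioo (h0 i hi) ht
  have hout : ∀ t, 0 ≤ t → ∀ i ∉ S, x t i = y i := fun t ht i hi =>
    (hx.apply_eq_of_abs_eq_one (hface i hi).1 ht).trans (hface i hi).2
  -- Times `t n ≥ n` at which the dissipation exceeds `-1 / (n + 1)`; it therefore vanishes at any
  -- limit point of `x (t n)`.
  choose t ht hq using fun n : ℕ => hx.exists_dissipation_gt hγ hy h0 hface hEy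
    (Nat.cast_nonneg n : (0 : ℝ) ≤ n) (Nat.one_div_pos_of_nat (n := n) (α := ℝ))
  have ht0 : ∀ n, 0 ≤ t n := fun n => (Nat.cast_nonneg n).trans (ht n)
  -- The strict bounds `r i < 1` keep limit points off the boundary in the coordinates of `S`.
  choose! r hr1 hr using exists_abs_le_of_lyapunov_le hγ hy (lyapunov γ S y (x 0))
  set K : Set (Fin N → ℝ) :=
    Set.univ.pi fun i => if i ∈ S then Set.Icc (-r i) (r i) else {y i} with hK
  have hKc : IsCompact K := isCompact_univ_pi fun i => by
    split_ifs
    · exact isCompact_Icc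
    · exact isCompact_singleton
  have hxK : ∀ n, x (t n) ∈ K := by
    intro n i _
    dsimp only
    split_ifs with hi
    · refine abs_le.1 (hr i hi (x (t n)) (hin _ (ht0 n)) ?_)
      have := hx.lyapunov_sub_le (γ := γ) (c := 0) h0 hface hEy le_rfl (ht0 n)
        fun s _ => hneg _
      linarith
    · exact hout _ (ht0 n) i hi
  obtain ⟨z, hzK, φ, hφ, hz⟩ := hKc.tendsto_subseq hxK
  have hzS : ∀ i ∈ S, z i ∈ Set.Ioo (-1 : ℝ) 1 := by
    intro i hi
    have := hzK i (Set.mem_univ i)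
    simp only [if_pos hi] at this
    exact ⟨by linarith [this.1, hr1 i hi], by linarith [this.2, hr1 i hi]⟩
  have hzy : ∀ i ∉ S, z i = y i := by
    intro i hi
    have := hzK i (Set.mem_univ i)
    simpa only [if_neg hi, Set.mem_singleton_iff] using this
  have hEz : E *ᵥ (z - y) = 0 := by
    apply hker
    refine le_antisymm (hneg _) ?_
    have h1 := ((continuous_dissipation E γ y).tendsto z).comp hz
    have h2 : Tendsto (fun n : ℕ => -(1 / ((φ n : ℝ) + 1))) atTop (𝓝 0) := by
      have h3 := (tendsto_one_div_add_atTop_nhds_zero_nat (𝕜 := ℝ)).neg.comp hφ.tendsto_atTop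
      rwa [neg_zero] at h3
    exact le_of_tendsto_of_tendsto' h2 h1 fun n => (hq (φ n)).le
  have hEz' : ∀ i ∈ S, (E *ᵥ z) i = 0 := by
    intro i hi
    have := congrFun hEz i
    rw [Matrix.mulVec_sub, Pi.sub_apply, hEy i hi] at this
    simpa using this
  have hfacez : ∀ i ∉ S, |x 0 i| = 1 ∧ x 0 i = z i := fun i hi =>
    ⟨(hface i hi).1, (hface i hi).2.trans (hzy i hi).symm⟩
  -- Change of reference point from `y` to `z`: the entropy relative to `z` is nonincreasing and
  -- tends to its minimum along the subsequence, hence along all times.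
  have hlim : Tendsto (fun s => lyapunov γ S z (x s) - lyapunov γ S z z) atTop (𝓝 0) := by
    have h1 : Tendsto (fun n => lyapunov γ S z (x (t (φ n)))) atTop (𝓝 (lyapunov γ S z z)) :=
      (continuousAt_lyapunov (γ := γ) (y := z) hzS).tendsto.comp hz
    rw [Metric.tendsto_atTop]
    intro ε hε
    obtain ⟨n, hn⟩ := (h1.eventually (gt_mem_nhds (lt_add_of_pos_right _ hε))).exists
    refine ⟨t (φ n), fun s hs => ?_⟩
    have h2 := hx.lyapunov_sub_le (γ := γ) (c := 0) h0 hfacez hEz' (ht0 (φ n)) hs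
      fun s _ => hneg _
    have h3 := lyapunov_self_le hγ hzS (hin s ((ht0 _).trans hs))
    rw [Real.dist_eq, sub_zero, abs_of_nonneg (sub_nonneg.2 h3)]
    linarith
  refine ⟨z, hzS, hzy, hEz, tendsto_pi_nhds.2 fun i => ?_⟩
  by_cases hi : i ∈ S
  · have h1 : Tendsto (fun s => (x s i - z i) ^ 2) atTop (𝓝 0) := by
      have h2 : Tendsto (fun s => 2 / γ i * (lyapunov γ S z (x s) - lyapunov γ S z z)) atTop
          (𝓝 0) := by
        simpa using hlim.const_mul (2 / γ i)
      refine squeeze_zero' (Eventually.of_forall fun s => sq_nonneg _) ?_ h2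
      filter_upwards [eventually_ge_atTop 0] with s hs
      have h3 := sq_le_lyapunov_sub hγ hzS (hin s hs) hi
      rw [div_mul_eq_mul_div, le_div_iff₀ (hγ i)]
      linarith
    have h2 : Tendsto (fun s => |x s i - z i|) atTop (𝓝 0) := by
      simpa [Real.sqrt_sq_eq_abs] using h1.sqrt
    exact tendsto_iff_dist_tendsto_zero.2 (by simpa [Real.dist_eq] using h2)
  · refine tendsto_const_nhds.congr' ?_
    filter_upwards [eventually_ge_atTop 0] with s hs
    rw [hout s hs i hi, hzy i hi]

end Convergence

/-! ### Identification of the limit -/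

lemma permuted_mulVec_inr {N k m : ℕ} (E : Matrix (Fin N) (Fin N) ℝ)
    (e : Fin k ⊕ Fin m ≃ Fin N) (u : Fin N → ℝ) (j : Fin m) :
    (E *ᵥ u) (e (Sum.inr j)) =
      ((permuted E e).toBlocks₂₁ *ᵥ fun i => u (e (Sum.inl i))) j +
        ((permuted E e).toBlocks₂₂ *ᵥ fun i => u (e (Sum.inr i))) j := by
  simp only [Matrix.mulVec, dotProduct]
  rw [← e.sum_comp, Fintype.sum_sum_type]
  rfl

section Critical

variable {N : ℕ} {E : Matrix (Fin N) (Fin N) ℝ} {x : ℝ → Fin N → ℝ} {γ v : Fin N → ℝ}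

/-- The reference point `(s / ‖v‖) • v` lies in `ker E` and equals `s` exactly on the maximal
coordinates. The limit differs from it by some `α • v` that vanishes at a maximal index, so `α = 0`.
-/
lemma IsSolution.tendsto_of_kernel_spanned (hx : IsSolution E x) (hN : 0 < N)
    (hγ : ∀ i, 0 < γ i)
    (hneg : ∀ w : Fin N → ℝ, ∑ i, γ i * (w i * (E *ᵥ w) i) ≤ 0)
    (hker : ∀ w : Fin N → ℝ, ∑ i, γ i * (w i * (E *ᵥ w) i) = 0 → E *ᵥ w = 0)
    (hv : ∀ i, 0 < v i) (hEv : E *ᵥ v = 0)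
    (hspan : ∀ w : Fin N → ℝ, E *ᵥ w = 0 → ∃ α : ℝ, w = α • v)
    {s : ℝ} (hs : |s| = 1) (hmax : ∀ i, v i = ‖v‖ → x 0 i = s)
    (hin : ∀ i, v i ≠ ‖v‖ → x 0 i ∈ Set.Ioo (-1 : ℝ) 1) :
    Tendsto x atTop (𝓝 ((s / ‖v‖) • v)) := by
  classical
  have hle : ∀ i, v i ≤ ‖v‖ := fun i => (le_abs_self _).trans (norm_le_pi_norm v i)
  have hnorm : 0 < ‖v‖ := (hv ⟨0, hN⟩).trans_le (hle _)
  obtain ⟨j, hj⟩ : ∃ j, v j = ‖v‖ := by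
    have : Nonempty (Fin N) := ⟨⟨0, hN⟩⟩
    obtain ⟨j, hj⟩ := Finite.exists_max v
    refine ⟨j, le_antisymm (hle j) ((pi_norm_le_iff_of_nonneg (hv j).le).2 fun i => ?_)⟩
    rw [Real.norm_of_nonneg (hv i).le]
    exact hj i
  set S : Finset (Fin N) := Finset.univ.filter fun i => v i ≠ ‖v‖ with hS
  have hmem : ∀ i, i ∈ S ↔ v i ≠ ‖v‖ := fun i => by simp [hS]
  have hEy : E *ᵥ ((s / ‖v‖) • v) = 0 := by rw [Matrix.mulVec_smul, hEv, smul_zero]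
  obtain ⟨z, -, hz, hEz, hlim⟩ := hx.exists_tendsto (S := S) (y := (s / ‖v‖) • v) hγ hneg hker
    (fun i hi => by
      refine abs_lt.1 ?_
      rw [Pi.smul_apply, smul_eq_mul, abs_mul, abs_div, hs, abs_norm, abs_of_pos (hv i),
        one_div_mul_eq_div, div_lt_one hnorm]
      exact lt_of_le_of_ne (hle i) ((hmem i).1 hi))
    (fun i hi => hin i ((hmem i).1 hi))
    (fun i hi => by
      have hi' : v i = ‖v‖ := by simpa [hmem] using hi
      rw [hmax i hi', Pi.smul_apply, smul_eq_mul, hi', div_mul_cancel₀ _ hnorm.ne']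
      exact ⟨hs, rfl⟩)
    (fun i _ => by rw [hEy]; rfl)
  obtain ⟨α, hα⟩ := hspan _ hEz
  have h1 := congrFun hα j
  rw [Pi.sub_apply, hz j (by simp [hmem, hj]), sub_self, Pi.smul_apply, smul_eq_mul] at h1
  have h2 : α = 0 := (mul_eq_zero.1 h1.symm).resolve_right (hv j).ne'
  rw [h2, zero_smul, sub_eq_zero] at hα
  rwa [hα] at hlim

end Critical

end OpinionDynamics

theorem theorem3 {N : ℕ} (hN : 0 < N)
    (B : Matrix (Fin N) (Fin N) ℝ) (σ : Fin N → ℝ)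
    (hσ : ∀ i, 0 < σ i) (hB : ∀ i, B i i = 0) (hconn : StronglyConnected B)
    (C : Matrix (Fin N) (Fin N) ℝ) (d : ℝ)
    (hC : (CaseB B σ d ∧ C = B) ∨ CaseC B σ C d)
    (hΓ : ∃ γ : Fin N → ℝ, (∀ i, 0 < γ i) ∧
      (-symPart (Matrix.diagonal γ * sysMatrix B σ)).PosSemidef ∧
      (symPart (Matrix.diagonal γ * sysMatrix B σ)).rank = (sysMatrix B σ).rank) :
    -- 1) solutions starting in the open cube
    (∀ v : Fin N → ℝ, IsPositiveEigenvector C v →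
      ∀ x : ℝ → Fin N → ℝ, IsSolution (sysMatrix B σ) x →
        (∀ i, x 0 i ∈ Set.Ioo (-1 : ℝ) 1) →
        ∃ α ∈ Set.Ioo (-(1 / ‖v‖)) (1 / ‖v‖), Tendsto x atTop (𝓝 (α • v))) ∧
    -- 2) solutions starting with some components frozen at `1` or `-1`
    (∀ (k m : ℕ) (e : Fin k ⊕ Fin m ≃ Fin N), 0 < k → 0 < m →
      IsUnit (permuted (sysMatrix B σ) e).toBlocks₂₂ →
      ∀ y₁ : Fin k → ℝ, (∀ i, |y₁ i| = 1) →
        (∀ j, reducedEquilibrium (sysMatrix B σ) e y₁ j ∈ Set.Ioo (-1 : ℝ) 1) →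
        ∀ x : ℝ → Fin N → ℝ, IsSolution (sysMatrix B σ) x →
          (∀ i, x 0 (e (Sum.inl i)) = y₁ i) →
          (∀ j, x 0 (e (Sum.inr j)) ∈ Set.Ioo (-1 : ℝ) 1) →
          Tendsto x atTop
            (𝓝 (assemble e y₁ (reducedEquilibrium (sysMatrix B σ) e y₁)))) ∧
    -- 3) critical case, maximal components of `v` frozen at `1`
    (d = rho C → ∀ v : Fin N → ℝ, IsPositiveEigenvector C v → v ≠ 1 →
      ∀ x : ℝ → Fin N → ℝ, IsSolution (sysMatrix B σ) x →
        (∀ i, v i = ‖v‖ → x 0 i = 1) →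
        (∀ i, v i ≠ ‖v‖ → x 0 i ∈ Set.Ioo (-1 : ℝ) 1) →
        Tendsto x atTop (𝓝 ((1 / ‖v‖) • v))) ∧
    -- 4) critical case, maximal components of `v` frozen at `-1`
    (d = rho C → ∀ v : Fin N → ℝ, IsPositiveEigenvector C v → v ≠ 1 →
      ∀ x : ℝ → Fin N → ℝ, IsSolution (sysMatrix B σ) x →
        (∀ i, v i = ‖v‖ → x 0 i = -1) →
        (∀ i, v i ≠ ‖v‖ → x 0 i ∈ Set.Ioo (-1 : ℝ) 1) →
        Tendsto x atTop (𝓝 (-((1 / ‖v‖) • v)))) := by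
  obtain ⟨γ, hγ, hpsd, hrank⟩ := hΓ
  have hneg := dissipation_nonpos hpsd
  have hker := fun w => mulVec_eq_zero_of_dissipation_eq_zero hpsd hrank (w := w)
  have hCE : EventuallyPositive C ∧ rho C ≤ d ∧
      sysMatrix B σ = C - d • (1 : Matrix (Fin N) (Fin N) ℝ) := by
    rcases hC with ⟨⟨h1, h2, h3⟩, rfl⟩ | ⟨-, h1, h2, h3⟩
    · refine ⟨h1, h3, ?_⟩
      rw [sysMatrix, funext h2, Matrix.smul_one_eq_diagonal]
    · refine ⟨h2, h3, ?_⟩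
      rw [sysMatrix, h1]
      abel
  obtain ⟨hCpos, hCd, hE⟩ := hCE
  have hEmul : ∀ w : Fin N → ℝ, sysMatrix B σ *ᵥ w = C *ᵥ w - d • w := fun w => by
    rw [hE, Matrix.sub_mulVec, Matrix.smul_mulVec, Matrix.one_mulVec]
  have hspan : ∀ v, IsPositiveEigenvector C v → ∀ w, sysMatrix B σ *ᵥ w = 0 →
      ∃ α : ℝ, w = α • v := fun v hv w hw =>
    hv.eq_smul_of_mulVec_eq hN hCpos hCd (sub_eq_zero.1 ((hEmul w).symm.trans hw))
  have hEv : d = rho C → ∀ v, IsPositiveEigenvector C v → sysMatrix B σ *ᵥ v = 0 := by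
    intro hd v hv
    rw [hEmul, hv.mulVec_eq hN hCpos, hd, sub_self]
  refine ⟨?_, ?_, ?_, ?_⟩
  · intro v hv x hx h0
    -- With no coordinate frozen, the origin is the reference point, so the limit itself lies in
    -- `ker E`.
    obtain ⟨z, hz, -, hEz, hlim⟩ := hx.exists_tendsto (S := Finset.univ) (y := 0) hγ hneg hker
      (fun i _ => by simp) (fun i _ => h0 i) (fun i hi => absurd (Finset.mem_univ i) hi)
      (fun i _ => by simp)
    rw [sub_zero] at hEz
    obtain ⟨α, rfl⟩ := hspan v hv z hEz
    refine ⟨α, abs_lt.1 ?_, hlim⟩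
    have hnorm : 0 < ‖v‖ := ((hv.1 ⟨0, hN⟩).trans_le (le_abs_self _)).trans_le
      (norm_le_pi_norm v ⟨0, hN⟩)
    rw [lt_div_iff₀ hnorm, ← Real.norm_eq_abs, ← norm_smul, pi_norm_lt_iff one_pos]
    exact fun i => abs_lt.2 (hz i (Finset.mem_univ i))
  · intro k m e _ _ hunit y₁ hy₁ hy₂ x hx h0 h0'
    classical
    set y₂ := reducedEquilibrium (sysMatrix B σ) e y₁ with hy₂def
    have hdet := (Matrix.isUnit_iff_isUnit_det _).1 hunit
    have hinl : ∀ i, assemble e y₁ y₂ (e (Sum.inl i)) = y₁ i := fun i => by simp [assemble]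
    have hinr : ∀ j, assemble e y₁ y₂ (e (Sum.inr j)) = y₂ j := fun j => by simp [assemble]
    set S : Finset (Fin N) := Finset.univ.filter fun i => (e.symm i).isRight with hS
    have hSmem : ∀ i, i ∈ S → ∃ j, i = e (Sum.inr j) := fun i hi => by
      obtain ⟨j, hj⟩ := Sum.isRight_iff.1 (by simpa [hS] using hi : (e.symm i).isRight = true)
      exact ⟨j, by rw [← hj, e.apply_symm_apply]⟩
    have hSnot : ∀ i, i ∉ S → ∃ j, i = e (Sum.inl j) := fun i hi => by
      obtain ⟨j, hj⟩ := Sum.isLeft_iff.1 (by simpa [hS] using hi : (e.symm i).isLeft = true)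
      exact ⟨j, by rw [← hj, e.apply_symm_apply]⟩
    obtain ⟨z, -, hz, hEz, hlim⟩ := hx.exists_tendsto (S := S) (y := assemble e y₁ y₂)
      hγ hneg hker
      (fun i hi => by
        obtain ⟨j, rfl⟩ := hSmem i hi
        rw [hinr]
        exact hy₂ j)
      (fun i hi => by
        obtain ⟨j, rfl⟩ := hSmem i hi
        exact h0' j)
      (fun i hi => by
        obtain ⟨j, rfl⟩ := hSnot i hi
        rw [hinl, h0]
        exact ⟨hy₁ j, rfl⟩)
      -- Only the free rows are required to vanish: there `Ē₂₁ y₁ + Ē₂₂ y₂ = 0` by the choice of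
      -- `y₂`.
      (fun i hi => by
        obtain ⟨j, rfl⟩ := hSmem i hi
        rw [permuted_mulVec_inr]
        simp only [hinl, hinr]
        rw [show (fun i => y₂ i) = y₂ from rfl, hy₂def, reducedEquilibrium, Matrix.mulVec_neg,
          Matrix.mulVec_mulVec, Matrix.mul_nonsing_inv _ hdet, Matrix.one_mulVec, Pi.neg_apply,
          add_neg_cancel])
    -- The difference `z - y` is zero on the frozen block and killed by `E`, so `Ē₂₂` kills its free
    -- block, which is then zero.
    suffices h : z = assemble e y₁ y₂ by rwa [h] at hlim
    have hzl : ∀ i, (z - assemble e y₁ y₂) (e (Sum.inl i)) = 0 := fun i => by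
      rw [Pi.sub_apply, hz _ (by simp [hS]), sub_self]
    have h22 : (permuted (sysMatrix B σ) e).toBlocks₂₂ *ᵥ
        (fun j => (z - assemble e y₁ y₂) (e (Sum.inr j))) = 0 := by
      ext j
      have h1 := permuted_mulVec_inr (sysMatrix B σ) e (z - assemble e y₁ y₂) j
      simp only [hzl] at h1
      rw [hEz, show (fun _ : Fin k => (0 : ℝ)) = 0 from rfl, Matrix.mulVec_zero, Pi.zero_apply,
        Pi.zero_apply, zero_add] at h1
      exact h1.symm
    have hzr := Matrix.eq_zero_of_mulVec_eq_zero hdet.ne_zero h22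
    refine sub_eq_zero.1 (funext fun i => ?_)
    obtain ⟨a, rfl⟩ := e.surjective i
    rcases a with a | a
    · exact hzl a
    · exact congrFun hzr a
  · intro hd v hv _ x hx hmax hin
    exact hx.tendsto_of_kernel_spanned hN hγ hneg hker hv.1 (hEv hd v hv) (hspan v hv)
      abs_one hmax hin
  · intro hd v hv _ x hx hmax hin
    have := hx.tendsto_of_kernel_spanned hN hγ hneg hker hv.1 (hEv hd v hv) (hspan v hv)
      (s := -1) (by simp) hmax hin
    rwa [neg_div, neg_smul] at this
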